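/- Conventions. An mm-space $X=(X,\rho,\mu)$ is a metric space with a Borel probability measure. A parametrization of $X$ is a measurable map $\phi\colon[0,1]\to X$ with $\phi_*\lambda=\mu$, where $\lambda$ is Lebesgue measure. For functions on $[0,1]$ let $\mathrm{me}_1(f,g)=\inf\{\varepsilon>0:\lambda\{|f-g|>\varepsilon\}<\varepsilon\}$. The Gromov distance $d_{conc}(X,Y)$ is the infimum of all $\varepsilon>0$ for which there are parametrizations $\phi_X,\phi_Y$ such that for every $1$-Lipschitz $f\colon X\to\mathbb R$ there is a $1$-Lipschitz $g\colon Y\to\mathbb R$ with $\mathrm{me}_1(f\circ\phi_X,g\circ\phi_Y)<\varepsilon$, and vice versa. A sequence $(X_n)$ of mm-spaces is a Lévy family if for every $\varepsilon>0$ the concentration functions $\alpha_{X_n}(\varepsilon)=1-\inf\{\mu_n(A_\varepsilon): A\subseteq X_n \text{ Borel},\ \mu_n(A)\ge 1/2\}$ tend to $0$, where $A_\varepsilon$ is the open $\varepsilon$-neighbourhood of $A$. Let $\mathscr M$ be a class of mm-spaces. A function $\partial\colon\mathscr M\to[0,\infty]$ is a dimension function if 1. a sequence $(X_n)$ in $\mathscr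 M$ is a Lévy family if and only if $\partial(X_n)\to\infty$; 2. if $X_n,X\in\mathscr M$ and $d_{conc}(X_n,X)\to0$, then $\partial(X_n)\to\partial(X)$; 3. for some sequence $(X_n)$ in $\mathscr M$ with $d_{conc}(X_n,\mathbb S^n)\to0$ one has $\partial(X_n)=\Theta(n)$; here $\mathbb S^n$ is the Euclidean unit sphere with its rotation-invariant probability measure. Corollary (dimension of Gaussian corruption). Let $\partial$ be a dimension function on a class $\mathscr M$. Let $M$ be a compact topological manifold with a Borel probability measure $\mu$, let $d_n$ be natural numbers with $d_n\to\infty$, and let $e_n\colon M\to\mathbb R^{d_n}$ be topological embeddings such that for every $\varepsilon>0$ the covering numbers (the least number of open $\varepsilon$-balls of the Euclidean metric covering $e_n(M)$) satisfy $N(e_n(M),\varepsilon)=o(d_n)$. Let $\sigma_n>0$ with $\sigma_n=O(1/\sqrt{d_n})$. Write $M_n$ for the set $e_n(M)$ with the Euclidean distance and the measure $(e_n)_*\mu$, and $C_n$ for $\mathbb R^{d_n}$ with the Euclidean distance and the measure $(e_n)_*\mu*\gamma_{d_n}(0,\sigma_n^2)$ (the Gaussian corruption of $M$), where $\gamma_d(0,\sigma^2)$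 is the centred Gaussian measure on $\mathbb R^d$ with covariance $\sigma^2\,\mathrm{Id}$. Assume that $C_n\in\mathscr M$ for all $n$. Then: (i) If all $e_n$ induce the same metric on $M$, so that $M$ is a single mm-space, represented by $M_0$, and if $M_0\in\mathscr M$, then $\partial(C_n)\to\partial(M_0)$ in $[0,\infty]$ as $n\to\infty$; that is, $\partial(C_n)\to\partial(M)$. (ii) More generally, if $X\in\mathscr M$ is an mm-space such that $d_{conc}(M_n,X)\to0$, then $\partial(C_n)\to\partial(X)$ in $[0,\infty]$ as $n\to\infty$. -/

import Mathlib

open MeasureTheory ProbabilityTheory Filter Topology Asymptotics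
open scoped NNReal ENNReal

noncomputable section

/-- A space with metric and measure: a metric space with a probability measure on its Borel sets. -/
structure MMSpace where
  carrier : Type
  [metric : MetricSpace carrier]
  [measurable : MeasurableSpace carrier]
  [borel : BorelSpace carrier]
  measure : Measure carrier
  [prob : IsProbabilityMeasure measure]

namespace MMSpace

attribute [instance] MMSpace.metric MMSpace.measurable MMSpace.borel MMSpace.prob

/-- A parametrization of `X` by the unit interval: a measurable map `[0,1] → X` which pushes the
Lebesgue measure forward to the measure of `X`. -/
def IsParametrization (X : MMSpace) (φ : unitInterval → X.carrier) : Prop :=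
  MeasurePreserving φ volume X.measure

/-- The distance `me₁` of convergence in measure between functions on `[0,1]`. -/
def me1 (f g : unitInterval → ℝ) : ℝ :=
  sInf {ε : ℝ | 0 < ε ∧ volume {t : unitInterval | ε < |f t - g t|} < ENNReal.ofReal ε}

/-- Under the parametrizations `φ`, `ψ`, all features (`1`-Lipschitz functions) of `X` and of `Y`
can be matched against one another up to `ε`. -/
def FeaturesMatch (X Y : MMSpace) (φ : unitInterval → X.carrier) (ψ : unitInterval → Y.carrier) (ε : ℝ) : Prop :=
  (∀ f : X.carrier → ℝ, LipschitzWith 1 f →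
    ∃ g : Y.carrier → ℝ, LipschitzWith 1 g ∧ me1 (f ∘ φ) (g ∘ ψ) < ε) ∧
  (∀ g : Y.carrier → ℝ, LipschitzWith 1 g →
    ∃ f : X.carrier → ℝ, LipschitzWith 1 f ∧ me1 (f ∘ φ) (g ∘ ψ) < ε)

/-- Gromov's (observable) distance between two mm-spaces: the infimum of all `ε > 0` for which some
parametrizations match the features up to `ε`. The infimum is taken in `[0,∞]`; it is finite as
soon as both spaces have a parametrization. -/
def dconc (X Y : MMSpace) : ℝ≥0∞ :=
  sInf {δ : ℝ≥0∞ | ∃ ε : ℝ, 0 < ε ∧ δ = ENNReal.ofReal ε ∧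
    ∃ (φ : unitInterval → X.carrier) (ψ : unitInterval → Y.carrier),
      X.IsParametrization φ ∧ Y.IsParametrization ψ ∧ FeaturesMatch X Y φ ψ ε}

/-- The concentration function `α_X`. -/
def concentrationFunction (X : MMSpace) (ε : ℝ≥0) : ℝ≥0∞ :=
  if ε = 0 then 1 / 2 else
    1 - ⨅ A ∈ {A : Set X.carrier | MeasurableSet A ∧ 1 / 2 ≤ X.measure A},
      X.measure (Metric.thickening ε A)

/-- A Lévy family: the concentration functions tend to zero pointwise on `(0,∞)`. -/
def IsLevyFamily (X : ℕ → MMSpace) : Prop :=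
  ∀ ε : ℝ≥0, 0 < ε → Tendsto (fun n => (X n).concentrationFunction ε) atTop (𝓝 0)

/-- The Euclidean unit sphere `𝕊ⁿ` in `ℝⁿ⁺¹` with the Euclidean distance and the normalized surface
measure. -/
def sphere (n : ℕ) : MMSpace where
  carrier := Metric.sphere (0 : EuclideanSpace ℝ (Fin (n + 1))) 1
  measure :=
    ((volume : Measure (EuclideanSpace ℝ (Fin (n + 1)))).toSphere Set.univ)⁻¹ •
      (volume : Measure (EuclideanSpace ℝ (Fin (n + 1)))).toSphere
  prob := by
    have : NeZero ((volume : Measure (EuclideanSpace ℝ (Fin (n + 1)))).toSphere) :=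
      ⟨Measure.toSphere_ne_zero _⟩
    infer_instance

/-- The axioms of an intrinsic dimension function `∂ : 𝓜 → [0,∞]` on a class `𝓜` of mm-spaces. -/
structure IsDimensionFunction (𝓜 : Set MMSpace) (dim : 𝓜 → ℝ≥0∞) : Prop where
  /-- Axiom of concentration. -/
  concentration : ∀ X : ℕ → 𝓜,
    IsLevyFamily (fun n => (X n : MMSpace)) ↔ Tendsto (fun n => dim (X n)) atTop (𝓝 ⊤)
  /-- Axiom of smooth dependence on datasets. -/
  smooth_dependence : ∀ (X : ℕ → 𝓜) (Y : 𝓜),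
    Tendsto (fun n => dconc (X n) Y) atTop (𝓝 0) → Tendsto (fun n => dim (X n)) atTop (𝓝 (dim Y))
  /-- Axiom of normalization: `∂(Xₙ) = Θ(n)` for some family in `𝓜` asymptotically approaching
  the spheres `𝕊ⁿ`. -/
  normalization : ∃ X : ℕ → 𝓜,
    Tendsto (fun n => dconc (X n) (sphere n)) atTop (𝓝 0) ∧
    ∃ c C : ℝ≥0, 0 < c ∧
      ∀ᶠ n : ℕ in atTop, (c : ℝ≥0∞) * n ≤ dim (X n) ∧ dim (X n) ≤ (C : ℝ≥0∞) * n

section Corruption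

variable {M : Type*} [TopologicalSpace M] [MeasurableSpace M] [BorelSpace M]
  (μ : Measure M) [IsProbabilityMeasure μ] {d : ℕ} (e : M → EuclideanSpace ℝ (Fin d))
  (he : IsEmbedding e)

/-- The image of `(M, μ)` in `ℝᵈ` under an embedding `e`: the set `e(M)` with the Euclidean distance
and the push-forward of `μ`. -/
def image : MMSpace where
  carrier := Set.range e
  measure := μ.map (Set.rangeFactorization e)
  prob := Measure.isProbabilityMeasure_map
    (he.continuous.subtype_mk _ : Continuous (Set.rangeFactorization e)).measurable.aemeasurable

/-- The Gaussian measure `γ_d(0,σ²)` on `ℝᵈ`, the law of `σ` times a standard Gaussian vector. -/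
def gaussianNoise (d : ℕ) (σ : ℝ) : Measure (EuclideanSpace ℝ (Fin d)) :=
  (stdGaussian (EuclideanSpace ℝ (Fin d))).map (fun x => σ • x)

instance (d : ℕ) (σ : ℝ) : IsProbabilityMeasure (gaussianNoise d σ) :=
  Measure.isProbabilityMeasure_map (by fun_prop)

/-- The Gaussian corruption of `(M, μ)` embedded in `ℝᵈ` by `e`: the space `ℝᵈ` with the Euclidean
distance and the convolution of the push-forward of `μ` with `γ_d(0,σ²)`. -/
def corruption (σ : ℝ) : MMSpace where
  carrier := EuclideanSpace ℝ (Fin d)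
  measure := (μ.map e).conv (gaussianNoise d σ)
  prob := by
    have : IsProbabilityMeasure (μ.map e) :=
      Measure.isProbabilityMeasure_map he.continuous.measurable.aemeasurable
    infer_instance

end Corruption

/-- The covering number `N(X, ε)` of a totally bounded metric space: the smallest number of open
balls of radius `ε` that cover `X`. -/
def coveringNumber (X : Type*) [MetricSpace X] (ε : ℝ) : ℕ :=
  sInf {k : ℕ | ∃ F : Finset X, F.card = k ∧ ∀ x : X, ∃ y ∈ F, x ∈ Metric.ball y ε}

end MMSpace

end

/-! By smooth dependence it suffices that `dconc` between the corruption and `X` tends to zero.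
Given a parametrization `ψ` of `e(M)`, the corruption is parametrized by the point `ψ` plus `σ`
times an independent Gaussian vector, and features are matched in both directions.

A feature `f` of the corruption is matched with its average `z ↦ E f(z + σY)`, restricted to `e(M)`.
A Poincaré inequality with a dimension-free constant (`variance_stdGaussian_le`) and Chebyshev bound
the error, since `σ → 0`.

Conversely, a feature `g` of `e(M)` must be extended to the whole space. An arbitrary extension can
fail, because the noise has norm of order `σ√d`, which need not be small. Instead, `g` is extended
and composed with the orthogonal projection onto the span of the centres of a finite `ε`-net. This
moves points of `e(M)` by at most `ε`, and the projected noise has second moment at most `σ² N(e(M),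
ε) = O(1/d) · o(d)`, which tends to zero (`exists_lipschitzWith_measure_lt_abs_sub_le`). -/

section Gaussian

/-! ### Gaussian Poincaré inequality by rotation. -/

theorem norm_rotate_sub_le {V : Type*} [NormedAddCommGroup V] [NormedSpace ℝ V] (θ : ℝ) (x y : V) :
    ‖Real.cos θ • x + Real.sin θ • y - x‖ ≤ |θ| * (‖x‖ + ‖y‖) := by
  have h1 : |Real.cos θ - 1| ≤ |θ| := by simpa using Real.abs_cos_sub_cos_le θ 0
  have h2 : |Real.sin θ| ≤ |θ| := Real.abs_sin_le_abs
  calc ‖Real.cos θ • x + Real.sin θ • y - x‖ = ‖(Real.cos θ - 1) • x + Real.sin θ • y‖ := by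
        congr 1; module
    _ ≤ |Real.cos θ - 1| * ‖x‖ + |Real.sin θ| * ‖y‖ := by
        simpa [norm_smul] using norm_add_le ((Real.cos θ - 1) • x) (Real.sin θ • y)
    _ ≤ |θ| * ‖x‖ + |θ| * ‖y‖ := by gcongr
    _ = _ := by ring

theorem tendsto_rotate_quotient {V : Type*} [NormedAddCommGroup V] [NormedSpace ℝ V]
    {f : V → ℝ} {x : V} (hf : DifferentiableAt ℝ f x) (y : V) :
    Tendsto (fun n : ℕ => ((n : ℝ) + 1) *
      (f (Real.cos (Real.pi / 2 / (n + 1)) • x + Real.sin (Real.pi / 2 / (n + 1)) • y) - f x))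
      atTop (𝓝 (Real.pi / 2 * fderiv ℝ f x y)) := by
  have hc : HasDerivAt (fun θ : ℝ => Real.cos θ • x + Real.sin θ • y) y 0 := by
    have := ((Real.hasDerivAt_cos 0).smul_const x).fun_add ((Real.hasDerivAt_sin 0).smul_const y)
    simpa only [neg_zero, Real.sin_zero, zero_smul, Real.cos_zero, one_smul, zero_add] using this
  have hx : HasFDerivAt f (fderiv ℝ f x) (Real.cos 0 • x + Real.sin 0 • y) := by
    simpa using hf.hasFDerivAt
  have hd := (hx.comp_hasDerivAt (0 : ℝ) hc).tendsto_slope_zero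
  have ht : Tendsto (fun n : ℕ => Real.pi / 2 / ((n : ℝ) + 1)) atTop (𝓝[≠] 0) := by
    refine tendsto_nhdsWithin_iff.2 ⟨?_, Eventually.of_forall fun n => ?_⟩
    · exact tendsto_const_nhds.div_atTop
        (tendsto_atTop_add_const_right _ _ tendsto_natCast_atTop_atTop)
    · have := Real.pi_pos
      simp only [Set.mem_compl_iff, Set.mem_singleton_iff]
      positivity
  refine ((hd.comp ht).const_mul (Real.pi / 2)).congr fun n => ?_
  have := Real.pi_pos
  simp only [Function.comp_apply, zero_add, Real.cos_zero, Real.sin_zero, one_smul, zero_smul,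
    add_zero, smul_eq_mul]
  field_simp

theorem MeasureTheory.Measure.AbsolutelyContinuous.pi_fin {α : Type*} [MeasurableSpace α]
    {μ ν : Measure α} [SigmaFinite μ] [SigmaFinite ν] (h : μ ≪ ν) (n : ℕ) :
    Measure.pi (fun _ : Fin n => μ) ≪ Measure.pi fun _ : Fin n => ν := by
  induction n with
  | zero => rw [Measure.pi_of_empty, Measure.pi_of_empty]
  | succ n ih =>
    rw [← (measurePreserving_piFinSuccAbove (fun _ : Fin (n + 1) => μ) 0).symm.map_eq,
      ← (measurePreserving_piFinSuccAbove (fun _ : Fin (n + 1) => ν) 0).symm.map_eq]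
    exact (h.prod ih).map (MeasurableEquiv.measurable _)

theorem stdGaussian_euclideanSpace_absolutelyContinuous (d : ℕ) :
    stdGaussian (EuclideanSpace ℝ (Fin d)) ≪ volume := by
  rw [← map_pi_eq_stdGaussian, ← (PiLp.volume_preserving_toLp (Fin d)).map_eq]
  exact ((gaussianReal_absolutelyContinuous 0 one_ne_zero).pi_fin d).map (by fun_prop)

variable {E : Type*} [NormedAddCommGroup E] [InnerProductSpace ℝ E] [FiniteDimensional ℝ E]
  [MeasurableSpace E] [BorelSpace E]

/-- Rademacher's theorem, transferred through absolute continuity with respect to a Haar measure. -/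
theorem LipschitzWith.ae_differentiableAt_stdGaussian {K : ℝ≥0} {f : E → ℝ}
    (hf : LipschitzWith K f) : ∀ᵐ x ∂stdGaussian E, DifferentiableAt ℝ f x := by
  let L := (stdOrthonormalBasis ℝ E).repr.symm
  rw [← stdGaussian_map L]
  have h := (stdGaussian_euclideanSpace_absolutelyContinuous (Module.finrank ℝ E)).map
    L.continuous.measurable
  have : (Measure.map L volume).IsAddHaarMeasure :=
    L.toContinuousLinearEquiv.isAddHaarMeasure_map volume
  exact h.ae_le hf.ae_differentiableAt

theorem memLp_two_of_lipschitzWith {K : ℝ≥0} {f : E → ℝ} (hf : LipschitzWith K f) :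
    MemLp f 2 (stdGaussian E) := by
  have hid : MemLp (fun x : E => x) 2 (stdGaussian E) := IsGaussian.memLp_two_id
  have hn : MemLp (fun x : E => (K : ℝ) * ‖x‖) 2 (stdGaussian E) := hid.norm.const_mul _
  have h : MemLp (fun x : E => ‖f 0‖ + K * ‖x‖) 2 (stdGaussian E) :=
    (memLp_const ‖f 0‖).add hn
  refine h.mono hf.continuous.aestronglyMeasurable (ae_of_all _ fun x => ?_)
  have h1 := hf.dist_le_mul x 0
  rw [dist_eq_norm, dist_zero_right] at h1
  have h2 : ‖f x‖ ≤ ‖f 0‖ + ‖f x - f 0‖ := by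
    simpa using norm_add_le (f 0) (f x - f 0)
  exact (h2.trans (add_le_add_right h1 _)).trans (Real.le_norm_self _)

theorem integral_sq_strongDual_stdGaussian (L : StrongDual ℝ E) :
    ∫ y, L y ^ 2 ∂stdGaussian E = ‖L‖ ^ 2 := by
  have h := variance_dual_stdGaussian L
  rwa [variance_of_integral_eq_zero L.continuous.aemeasurable
    (integral_strongDual_stdGaussian L)] at h

/-- The increments of `θ ↦ f (cos θ x + sin θ y)` are stationary for Gaussian `(x, y)`. -/
theorem integral_sq_rotate_increment (f : E → ℝ) (hf : Continuous f) (s h : ℝ) :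
    ∫ p, (f (Real.cos (s + h) • p.1 + Real.sin (s + h) • p.2) -
        f (Real.cos s • p.1 + Real.sin s • p.2)) ^ 2 ∂(stdGaussian E).prod (stdGaussian E) =
      ∫ p, (f (Real.cos h • p.1 + Real.sin h • p.2) - f p.1) ^ 2
        ∂(stdGaussian E).prod (stdGaussian E) := by
  -- The law of `(x, y)` is invariant under rotation by `s`, which carries the curve at angle `h` to
  -- the curve at angle `s + h`.
  have hrot := IsGaussian.map_rotation_eq_self (μ := stdGaussian E)
    integral_id_stdGaussian s
  conv_rhs => rw [← hrot]
  rw [integral_map (by fun_prop) (by fun_prop)]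
  refine integral_congr_ae (ae_of_all _ fun p => ?_)
  simp only [ContinuousLinearMap.rotation_apply]
  congr 3
  rw [Real.cos_add, Real.sin_add]
  module

theorem integrable_sq_rotate_increment {K : ℝ≥0} {f : E → ℝ} (hf : LipschitzWith K f) (s t : ℝ) :
    Integrable (fun p : E × E => (f (Real.cos s • p.1 + Real.sin s • p.2) -
        f (Real.cos t • p.1 + Real.sin t • p.2)) ^ 2)
      ((stdGaussian E).prod (stdGaussian E)) := by
  have key : ∀ s : ℝ, MemLp (fun p : E × E => f (Real.cos s • p.1 + Real.sin s • p.2)) 2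
      ((stdGaussian E).prod (stdGaussian E)) := fun s => by
    have hrot := IsGaussian.map_rotation_eq_self (μ := stdGaussian E)
      integral_id_stdGaussian s
    have h1 : MemLp (fun p : E × E => f p.1) 2 ((stdGaussian E).prod (stdGaussian E)) :=
      (memLp_two_of_lipschitzWith hf).comp_fst _
    rw [← hrot] at h1
    exact h1.comp_of_map (by fun_prop)
  exact ((key s).sub (key t)).integrable_sq

/-- The quarter circle from `x` to `y` is cut into `n + 1` equal arcs. Cauchy–Schwarz costs a factor
`n + 1`, and by stationarity the `n + 1` arcs contribute equally. -/
theorem integral_sq_sub_le_mul (K : ℝ≥0) {f : E → ℝ} (hf : LipschitzWith K f) (n : ℕ) :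
    ∫ p, (f p.2 - f p.1) ^ 2 ∂(stdGaussian E).prod (stdGaussian E) ≤
      ∫ p, (((n : ℝ) + 1) * (f (Real.cos (Real.pi / 2 / (n + 1)) • p.1 +
        Real.sin (Real.pi / 2 / (n + 1)) • p.2) - f p.1)) ^ 2
          ∂(stdGaussian E).prod (stdGaussian E) := by
  set P := (stdGaussian E).prod (stdGaussian E)
  set h : ℝ := Real.pi / 2 / (n + 1) with hh
  set u : ℝ → E × E → ℝ := fun s p => f (Real.cos s • p.1 + Real.sin s • p.2) with hu
  have hint : ∀ k : ℕ, Integrable (fun p => (u (k * h + h) p - u (k * h) p) ^ 2) P :=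
    fun k => integrable_sq_rotate_increment hf _ _
  have htel : ∀ p, f p.2 - f p.1 =
      ∑ k ∈ Finset.range (n + 1), (u (k * h + h) p - u (k * h) p) := fun p => by
    have := Finset.sum_range_sub (fun k : ℕ => u (k * h) p) (n + 1)
    simp only [Nat.cast_add, Nat.cast_one, add_mul, one_mul, Nat.cast_zero, zero_mul] at this
    rw [this]
    have h2 : (n : ℝ) * h + h = Real.pi / 2 := by rw [hh]; field_simp
    simp [hu, h2]
  calc ∫ p, (f p.2 - f p.1) ^ 2 ∂P
      ≤ ∫ p, ((n : ℝ) + 1) * ∑ k ∈ Finset.range (n + 1), (u (k * h + h) p - u (k * h) p) ^ 2 ∂P := by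
        refine integral_mono_of_nonneg (ae_of_all _ fun p => sq_nonneg _)
          ((integrable_finsetSum _ fun k _ => hint k).const_mul _) (ae_of_all _ fun p => ?_)
        have := sq_sum_le_card_mul_sum_sq (s := Finset.range (n + 1))
          (f := fun k : ℕ => u (k * h + h) p - u (k * h) p)
        simp only [Finset.card_range, Nat.cast_add, Nat.cast_one] at this
        simpa only [htel p] using this
    _ = ((n : ℝ) + 1) * ∑ k ∈ Finset.range (n + 1), ∫ p, (u h p - f p.1) ^ 2 ∂P := by
        rw [integral_const_mul, integral_finsetSum _ fun k _ => hint k]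
        congr 1
        exact Finset.sum_congr rfl fun k _ => integral_sq_rotate_increment f hf.continuous _ _
    _ = _ := by
        simp only [mul_pow]
        rw [integral_const_mul, Finset.sum_const, Finset.card_range, nsmul_eq_mul]
        push_cast
        ring

/-- As the arcs shrink, the difference quotients tend to `π/2` times the derivative of `f` at `x` in
direction `y`; for fixed `x`, its square averages over `y` to `‖Df(x)‖² ≤ K²`. -/
theorem integral_sq_sub_le {K : ℝ≥0} {f : E → ℝ} (hf : LipschitzWith K f) :
    ∫ p, (f p.2 - f p.1) ^ 2 ∂(stdGaussian E).prod (stdGaussian E) ≤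
      (Real.pi / 2) ^ 2 * K ^ 2 := by
  set P := (stdGaussian E).prod (stdGaussian E)
  have hpi := Real.pi_pos
  have hnorm : MemLp (fun p : E × E => ‖p.1‖ + ‖p.2‖) 2 P :=
    ((IsGaussian.memLp_two_id (μ := stdGaussian E)).norm.comp_fst _).add
      ((IsGaussian.memLp_two_id (μ := stdGaussian E)).norm.comp_snd _)
  have hdiff : ∀ᵐ p ∂P, DifferentiableAt ℝ f p.1 :=
    Measure.quasiMeasurePreserving_fst.ae
      hf.ae_differentiableAt_stdGaussian
  have hlim : Tendsto (fun n : ℕ => ∫ p, (((n : ℝ) + 1) * (f (Real.cos (Real.pi / 2 / (n + 1)) • p.1 +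
        Real.sin (Real.pi / 2 / (n + 1)) • p.2) - f p.1)) ^ 2 ∂P) atTop
      (𝓝 (∫ p, (Real.pi / 2 * fderiv ℝ f p.1 p.2) ^ 2 ∂P)) := by
    refine tendsto_integral_of_dominated_convergence
      (fun p => (Real.pi / 2 * K * (‖p.1‖ + ‖p.2‖)) ^ 2) (fun n => ?_)
      (hnorm.const_mul (Real.pi / 2 * K)).integrable_sq (fun n => ae_of_all _ fun p => ?_) ?_
    · have := hf.continuous
      exact Continuous.aestronglyMeasurable (by fun_prop)
    · rw [norm_pow, Real.norm_eq_abs]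
      refine pow_le_pow_left₀ (abs_nonneg _) ?_ 2
      have h1 := hf.dist_le_mul (Real.cos (Real.pi / 2 / (n + 1)) • p.1 +
        Real.sin (Real.pi / 2 / (n + 1)) • p.2) p.1
      rw [dist_eq_norm, dist_eq_norm, Real.norm_eq_abs] at h1
      have h2 := norm_rotate_sub_le (Real.pi / 2 / (n + 1)) p.1 p.2
      rw [abs_of_nonneg (by positivity)] at h2
      rw [abs_mul, abs_of_nonneg (by positivity : (0 : ℝ) ≤ n + 1)]
      calc ((n : ℝ) + 1) * _ ≤ (n + 1) * (K * (Real.pi / 2 / (n + 1) * (‖p.1‖ + ‖p.2‖))) := by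
            gcongr
            exact h1.trans (by gcongr)
        _ = _ := by field_simp
    · filter_upwards [hdiff] with p hp
      exact (tendsto_rotate_quotient hp p.2).pow 2
  refine (ge_of_tendsto' hlim fun n => integral_sq_sub_le_mul K hf n).trans ?_
  have hmeas : Measurable fun p : E × E => fderiv ℝ f p.1 p.2 :=
    isBoundedBilinearMap_apply.continuous.measurable.comp
      (((measurable_fderiv ℝ f).comp measurable_fst).prodMk measurable_snd)
  have hbd : ∀ x : E, ‖fderiv ℝ f x‖ ≤ K := fun x => norm_fderiv_le_of_lipschitz ℝ hf
  have hint : Integrable (fun p : E × E => fderiv ℝ f p.1 p.2 ^ 2) P := by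
    refine ((((IsGaussian.memLp_two_id (μ := stdGaussian E)).norm.comp_snd
      (stdGaussian E)).const_mul (K : ℝ)).mono hmeas.aestronglyMeasurable
        (ae_of_all _ fun p => ?_)).integrable_sq
    rw [Real.norm_of_nonneg (r := K * _) (by positivity)]
    exact (ContinuousLinearMap.le_opNorm _ _).trans
      (mul_le_mul_of_nonneg_right (hbd p.1) (norm_nonneg _))
  simp only [mul_pow _ _ 2]
  rw [integral_const_mul]
  refine mul_le_mul_of_nonneg_left ?_ (by positivity)
  rw [integral_prod _ hint]
  calc ∫ x, ∫ y, fderiv ℝ f x y ^ 2 ∂stdGaussian E ∂stdGaussian E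
      ≤ ∫ _, (K : ℝ) ^ 2 ∂stdGaussian E := by
        refine integral_mono hint.integral_prod_left (integrable_const _) fun x => ?_
        simp only [integral_sq_strongDual_stdGaussian]
        exact pow_le_pow_left₀ (norm_nonneg _) (hbd x) 2
    _ = _ := by simp

/-- A Poincaré inequality for Lipschitz functions of a standard Gaussian vector. -/
theorem variance_stdGaussian_le {K : ℝ≥0} {f : E → ℝ} (hf : LipschitzWith K f) :
    Var[f; stdGaussian E] ≤ 2 * K ^ 2 := by
  have hL := memLp_two_of_lipschitzWith hf
  have h := integral_sq_sub_le hf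
  have h1 : Integrable f (stdGaussian E) := hL.integrable one_le_two
  have h2 : Integrable (fun x => f x ^ 2) (stdGaussian E) := hL.integrable_sq
  -- For independent copies the mean squared difference is twice the variance; with `(π/2)² ≤ 4`
  -- this gives the constant `2`.
  have hexp : ∫ p, (f p.2 - f p.1) ^ 2 ∂(stdGaussian E).prod (stdGaussian E) =
      2 * Var[f; stdGaussian E] := by
    have e : ∀ p : E × E, (f p.2 - f p.1) ^ 2 =
        f p.2 ^ 2 + f p.1 ^ 2 - 2 * (f p.1 * f p.2) := fun p => by ring
    simp only [e]
    have i1 := h2.comp_fst (stdGaussian E)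
    have i2 := h2.comp_snd (stdGaussian E)
    rw [integral_sub (f := fun p : E × E => f p.2 ^ 2 + f p.1 ^ 2) (i2.add i1)
        ((h1.mul_prod h1).const_mul 2),
      integral_add i2 i1, integral_const_mul, integral_prod_mul,
      integral_fun_snd (fun x => f x ^ 2), integral_fun_fst (fun x => f x ^ 2), variance_eq_sub hL]
    simp
    ring
  have hpi : (Real.pi / 2) ^ 2 ≤ 4 := by
    have := Real.pi_le_four
    have := Real.pi_pos
    nlinarith
  have : (Real.pi / 2) ^ 2 * (K : ℝ) ^ 2 ≤ 4 * K ^ 2 := by gcongr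
  linarith

/-- The projection of a standard Gaussian vector to a subspace of dimension `k` has second moment
`k`. -/
theorem integral_norm_sq_starProjection (V : Submodule ℝ E) :
    ∫ y, ‖V.starProjection y‖ ^ 2 ∂stdGaussian E = Module.finrank ℝ V := by
  let b := stdOrthonormalBasis ℝ V
  have h : ∀ y : E, ‖V.starProjection y‖ ^ 2 = ∑ i, innerSL ℝ (b i : E) y ^ 2 := fun y => by
    rw [V.starProjection_apply, ← Submodule.coe_norm, ← b.sum_sq_norm_inner_right]
    refine Finset.sum_congr rfl fun i _ => ?_
    rw [Real.norm_eq_abs, sq_abs, innerSL_apply_apply, Submodule.coe_inner,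
      ← V.starProjection_apply, ← V.inner_starProjection_left_eq_right,
      V.starProjection_eq_self_iff.2 (b i).2]
  simp only [h]
  rw [integral_finsetSum]
  · simp only [integral_sq_strongDual_stdGaussian, innerSL_apply_norm, ← Submodule.coe_norm,
      b.norm_eq_one]
    simp
  · intro i _
    exact (((innerSL ℝ (b i : E)).comp_memLp' IsGaussian.memLp_two_id)).integrable_sq

end Gaussian

theorem exists_measurePreserving_unitInterval {Y : Type*} [MeasurableSpace Y] [StandardBorelSpace Y]
    (ν : Measure Y) [IsProbabilityMeasure ν] :
    ∃ p : unitInterval → Y, MeasurePreserving p volume ν := by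
  have : Nonempty Y := nonempty_of_isProbabilityMeasure ν
  obtain ⟨f, hf, h⟩ := ν.exists_measurable_map_eq
  exact ⟨f, hf, h⟩

theorem measurable_rangeFactorization {α β : Type*} [TopologicalSpace α] [MeasurableSpace α]
    [BorelSpace α] [TopologicalSpace β] [MeasurableSpace β] [BorelSpace β] {f : α → β}
    (hf : Continuous f) : Measurable (Set.rangeFactorization f) :=
  (hf.subtype_mk _ : Continuous (Set.rangeFactorization f)).measurable

/-! ### Lipschitz functions under Gaussian noise. -/

section Smoothing

theorem lipschitzWith_add_smul {E : Type*} [NormedAddCommGroup E] [NormedSpace ℝ E] {f : E → ℝ}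
    (hf : LipschitzWith 1 f) (z : E) (σ : ℝ≥0) :
    LipschitzWith σ fun y => f (z + (σ : ℝ) • y) := by
  refine LipschitzWith.of_dist_le_mul fun x y => ?_
  simpa [dist_smul₀] using hf.dist_le_mul (z + (σ : ℝ) • x) (z + (σ : ℝ) • y)

variable {E : Type*} [NormedAddCommGroup E] [InnerProductSpace ℝ E] [FiniteDimensional ℝ E]
  [MeasurableSpace E] [BorelSpace E]

theorem lipschitzWith_integral_stdGaussian {f : E → ℝ} (hf : LipschitzWith 1 f) (σ : ℝ≥0) :
    LipschitzWith 1 fun z => ∫ y, f (z + (σ : ℝ) • y) ∂stdGaussian E := by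
  have hi : ∀ z, Integrable (fun y => f (z + (σ : ℝ) • y)) (stdGaussian E) := fun z =>
    (memLp_two_of_lipschitzWith (lipschitzWith_add_smul hf z σ)).integrable one_le_two
  refine LipschitzWith.of_dist_le_mul fun z w => ?_
  rw [dist_eq_norm, ← integral_sub (hi z) (hi w)]
  have := norm_integral_le_of_norm_le_const (μ := stdGaussian E)
    (f := fun y => f (z + (σ : ℝ) • y) - f (w + (σ : ℝ) • y)) (C := dist z w) <|
      ae_of_all _ fun y => by
        simpa [dist_eq_norm] using hf.dist_le_mul (z + (σ : ℝ) • y) (w + (σ : ℝ) • y)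
  simpa using this

variable {S : Type*} [MeasurableSpace S] (ν : Measure S) [IsProbabilityMeasure ν]

/-- A Lipschitz function of a variable with Gaussian noise is close to its average over the
noise. -/
theorem measure_lt_abs_sub_integral_le {s : S → E} (hs : Measurable s) {f : E → ℝ}
    (hf : LipschitzWith 1 f) (σ : ℝ≥0) {δ : ℝ} (hδ : 0 < δ) :
    (ν.prod (stdGaussian E)) {p | δ < |f (s p.1 + (σ : ℝ) • p.2) -
      ∫ y, f (s p.1 + (σ : ℝ) • y) ∂stdGaussian E|} ≤ ENNReal.ofReal (2 * σ ^ 2 / δ ^ 2) := by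
  have hg := (lipschitzWith_integral_stdGaussian hf σ).continuous.measurable
  have hm : MeasurableSet {p : S × E | δ < |f (s p.1 + (σ : ℝ) • p.2) -
      ∫ y, f (s p.1 + (σ : ℝ) • y) ∂stdGaussian E|} := by
    have h1 : Measurable fun p : S × E => f (s p.1 + (σ : ℝ) • p.2) :=
      hf.continuous.measurable.comp (by fun_prop)
    have h2 := hg.comp (hs.comp (measurable_fst : Measurable (Prod.fst : S × E → S)))
    exact measurableSet_lt measurable_const (h1.sub h2).abs
  rw [Measure.prod_apply hm]
  -- Chebyshev on each slice `t`, where the variance bound does not depend on `s t`.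
  refine (lintegral_mono fun t => ?_).trans (b := ∫⁻ _, ENNReal.ofReal (2 * σ ^ 2 / δ ^ 2) ∂ν)
    (by simp)
  have hL := lipschitzWith_add_smul hf (s t) σ
  refine (measure_mono fun y hy => ?_).trans ((meas_ge_le_variance_div_sq
    (memLp_two_of_lipschitzWith hL) hδ).trans (ENNReal.ofReal_le_ofReal ?_))
  · exact (Set.mem_ofPred_eq.mp hy : δ < _).le
  · gcongr
    exact variance_stdGaussian_le hL

/-- A Lipschitz function on a set covered by few balls extends to a Lipschitz function on the whole
space which is insensitive to Gaussian noise. -/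
theorem exists_lipschitzWith_measure_lt_abs_sub_le {T : Set E} {g : T → ℝ} (hg : LipschitzWith 1 g)
    (F : Finset T) {ε : ℝ} (hε : 0 < ε) (hF : ∀ x : T, ∃ y ∈ F, x ∈ Metric.ball y ε) (σ : ℝ≥0) :
    ∃ f : E → ℝ, LipschitzWith 1 f ∧ ∀ s : S → T,
      (ν.prod (stdGaussian E)) {p | 2 * ε < |f (s p.1 + (σ : ℝ) • p.2) - g (s p.1)|} ≤
        ENNReal.ofReal (σ ^ 2 * F.card / ε ^ 2) := by
  classical
  let V : Submodule ℝ E := Submodule.span ℝ (F.image ((↑) : T → E) : Set E)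
  have hVcard : (Module.finrank ℝ V : ℝ) ≤ F.card := by
    exact_mod_cast (finrank_span_finset_le_card (F.image ((↑) : T → E))).trans Finset.card_image_le
  obtain ⟨g', hg', hgg'⟩ : ∃ g' : E → ℝ, LipschitzWith 1 g' ∧ ∀ x : T, g' x = g x := by
    let g₀ : E → ℝ := Function.extend (↑) g 0
    have h₀ : ∀ x : T, g₀ x = g x := Subtype.val_injective.extend_apply g 0
    obtain ⟨g', h1, h2⟩ := LipschitzOnWith.extend_real (f := g₀) (s := T) (K := 1)
      (LipschitzOnWith.of_dist_le_mul fun x hx y hy => by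
        have := hg.dist_le_mul ⟨x, hx⟩ ⟨y, hy⟩
        rwa [← h₀ ⟨x, hx⟩, ← h₀ ⟨y, hy⟩] at this)
    exact ⟨g', h1, fun x => (h2 x.2).symm.trans (h₀ x)⟩
  have hP : LipschitzWith 1 V.starProjection := V.lipschitzWith_starProjection
  refine ⟨g' ∘ V.starProjection, by simpa using hg'.comp hP, fun s => ?_⟩
  have hnear : ∀ x : T, ‖V.starProjection x - (x : E)‖ ≤ ε := fun x => by
    obtain ⟨a, ha, hxa⟩ := hF x
    have haV : (a : E) ∈ V := Submodule.subset_span (by simpa using ha)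
    -- The projection is the nearest point of `V`, hence no farther from `x` than the net point `a`.
    rw [norm_sub_rev, V.starProjection_minimal]
    refine (ciInf_le ⟨0, Set.forall_mem_range.2 fun _ => norm_nonneg _⟩ (⟨a, haV⟩ : V)).trans ?_
    rw [← dist_eq_norm]
    exact (Metric.mem_ball.1 hxa).le
  -- The deviation is at most `ε + σ‖Py‖`, with `P` the projection onto `V`, so exceeding `2ε`
  -- forces `σ‖Py‖ ≥ ε`; Markov's inequality applies to the square.
  have hsub : {p : S × E | 2 * ε < |(g' ∘ V.starProjection) (s p.1 + (σ : ℝ) • p.2) - g (s p.1)|} ⊆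
      Prod.snd ⁻¹' {y | ε ^ 2 ≤ (σ : ℝ) ^ 2 * ‖V.starProjection y‖ ^ 2} := fun p hp => by
    simp only [Set.mem_ofPred_eq, Function.comp_apply, ← hgg'] at hp
    have h1 := hg'.dist_le_mul (V.starProjection (s p.1 + (σ : ℝ) • p.2)) (s p.1)
    rw [Real.dist_eq, dist_eq_norm, NNReal.coe_one, one_mul, map_add, map_smul] at h1
    have h2 : ‖V.starProjection (s p.1) + (σ : ℝ) • V.starProjection p.2 - (s p.1 : E)‖ ≤
        ‖V.starProjection (s p.1) - (s p.1 : E)‖ + σ * ‖V.starProjection p.2‖ := by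
      rw [add_sub_right_comm]
      refine (norm_add_le _ _).trans ?_
      simp [norm_smul]
    have h3 := hnear (s p.1)
    rw [map_add, map_smul] at hp
    simp only [Set.mem_preimage, Set.mem_ofPred_eq, ← mul_pow]
    exact pow_le_pow_left₀ hε.le (by linarith) 2
  have hint : Integrable (fun y => (σ : ℝ) ^ 2 * ‖V.starProjection y‖ ^ 2) (stdGaussian E) :=
    ((V.starProjection.comp_memLp' (IsGaussian.memLp_two_id (μ := stdGaussian E))).norm
      ).integrable_sq.const_mul _
  have hmarkov := mul_meas_ge_le_integral_of_nonneg
    (ae_of_all (stdGaussian E) fun y => by positivity) hint (ε ^ 2)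
  rw [integral_const_mul, integral_norm_sq_starProjection, ← le_div_iff₀' (by positivity)] at hmarkov
  refine (measure_mono hsub).trans ?_
  have hsnd : MeasurePreserving (Prod.snd : S × E → E) (ν.prod (stdGaussian E)) (stdGaussian E) :=
    measurePreserving_snd
  rw [hsnd.measure_preimage (measurableSet_le measurable_const (by fun_prop)).nullMeasurableSet,
    ← ofReal_measureReal]
  refine ENNReal.ofReal_le_ofReal (hmarkov.trans ?_)
  gcongr

end Smoothing

/-! ### Calculus of `me1` and `dconc`. -/

namespace MMSpace

theorem me1_lt_iff {f g : unitInterval → ℝ} {ε : ℝ} :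
    me1 f g < ε ↔
      ∃ δ, 0 < δ ∧ δ < ε ∧ volume {t | δ < |f t - g t|} < ENNReal.ofReal δ := by
  constructor
  · intro h
    have hne : {ε : ℝ | 0 < ε ∧
        volume {t : unitInterval | ε < |f t - g t|} < ENNReal.ofReal ε}.Nonempty := by
      -- Any number above the total mass `1` is admissible.
      refine ⟨2, two_pos, prob_le_one.trans_lt ?_⟩
      rw [← ENNReal.ofReal_one]
      exact (ENNReal.ofReal_lt_ofReal_iff two_pos).2 one_lt_two
    obtain ⟨δ, ⟨h0, h1⟩, h2⟩ := exists_lt_of_csInf_lt hne h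
    exact ⟨δ, h0, h2, h1⟩
  · rintro ⟨δ, h0, h1, h2⟩
    exact lt_of_le_of_lt (csInf_le ⟨0, fun _ h => h.1.le⟩ (Set.mem_ofPred.2 ⟨h0, h2⟩)) h1

theorem me1_lt_add {f g h : unitInterval → ℝ} {ε ε' : ℝ} (hfg : me1 f g < ε) (hgh : me1 g h < ε') :
    me1 f h < ε + ε' := by
  obtain ⟨δ, h0, h1, h2⟩ := me1_lt_iff.1 hfg
  obtain ⟨δ', h0', h1', h2'⟩ := me1_lt_iff.1 hgh
  refine me1_lt_iff.2 ⟨δ + δ', by positivity, by linarith, ?_⟩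
  calc volume {t | δ + δ' < |f t - h t|}
      ≤ volume ({t | δ < |f t - g t|} ∪ {t | δ' < |g t - h t|}) := measure_mono fun t ht => by
        by_contra hcon
        simp only [Set.mem_union, Set.mem_ofPred_eq, not_or, not_lt] at hcon ht
        have := abs_sub_le (f t) (g t) (h t)
        linarith
    _ ≤ _ := measure_union_le _ _
    _ < ENNReal.ofReal δ + ENNReal.ofReal δ' := ENNReal.add_lt_add h2 h2'
    _ = _ := (ENNReal.ofReal_add h0.le h0'.le).symm

theorem me1_comp_le {f g : unitInterval → ℝ} (hf : Measurable f) (hg : Measurable g)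
    {p : unitInterval → unitInterval} (hp : MeasurePreserving p) {ε : ℝ} (h : me1 f g < ε) :
    me1 (f ∘ p) (g ∘ p) < ε := by
  obtain ⟨δ, h0, h1, h2⟩ := me1_lt_iff.1 h
  refine me1_lt_iff.2 ⟨δ, h0, h1, ?_⟩
  have hm : MeasurableSet {t | δ < |f t - g t|} :=
    measurableSet_lt measurable_const (hf.sub hg).abs
  rwa [← hp.measure_preimage hm.nullMeasurableSet] at h2

theorem dconc_le {X Y : MMSpace} {φ : unitInterval → X.carrier} {ψ : unitInterval → Y.carrier}
    (hφ : X.IsParametrization φ) (hψ : Y.IsParametrization ψ) {ε : ℝ} (hε : 0 < ε)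
    (h : FeaturesMatch X Y φ ψ ε) : dconc X Y ≤ ENNReal.ofReal ε :=
  sInf_le ⟨ε, hε, rfl, φ, ψ, hφ, hψ, h⟩

theorem exists_featuresMatch_of_dconc_lt {X Y : MMSpace} {ε : ℝ}
    (h : dconc X Y < ENNReal.ofReal ε) :
    ∃ δ, 0 < δ ∧ δ < ε ∧ ∃ (φ : unitInterval → X.carrier) (ψ : unitInterval → Y.carrier),
      X.IsParametrization φ ∧ Y.IsParametrization ψ ∧ FeaturesMatch X Y φ ψ δ := by
  obtain ⟨_, ⟨δ, h0, rfl, h1⟩, h2⟩ := sInf_lt_iff.1 h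
  exact ⟨δ, h0, (ENNReal.ofReal_lt_ofReal_iff_of_nonneg h0.le).1 h2, h1⟩

/-- Isomorphic mm-spaces have distance zero. -/
theorem dconc_eq_zero_of_isometryEquiv {X Y : MMSpace} (ι : X.carrier ≃ᵢ Y.carrier)
    (hι : MeasurePreserving ι X.measure Y.measure) {φ : unitInterval → X.carrier}
    (hφ : X.IsParametrization φ) : dconc X Y = 0 := by
  have hself : ∀ (f : unitInterval → ℝ) {ε : ℝ}, 0 < ε → me1 f f < ε := fun f ε hε =>
    me1_lt_iff.2 ⟨ε / 2, by positivity, by linarith, by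
      have : ¬ ε / 2 < 0 := by linarith
      simp [this, hε]⟩
  refine le_antisymm (ENNReal.le_of_forall_pos_le_add fun ε hε _ => ?_) bot_le
  rw [zero_add, ← ENNReal.ofReal_coe_nnreal]
  refine dconc_le hφ (hι.comp hφ) (NNReal.coe_pos.2 hε) ⟨fun f hf => ?_, fun g hg => ?_⟩
  · refine ⟨f ∘ ι.symm, by simpa using hf.comp ι.symm.isometry.lipschitz, ?_⟩
    have : (f ∘ ι.symm) ∘ ι ∘ φ = f ∘ φ := by ext t; simp
    rw [this]
    exact hself _ hε
  · exact ⟨g ∘ ι, by simpa using hg.comp ι.isometry.lipschitz, hself _ hε⟩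

/-- Compactness makes the set of cardinalities nonempty, so the infimum is attained and is not the
default value `0` of `sInf ∅`. -/
theorem exists_finset_card_eq_coveringNumber (X : Type*) [MetricSpace X] [CompactSpace X] {ε : ℝ}
    (hε : 0 < ε) : ∃ F : Finset X, F.card = coveringNumber X ε ∧
      ∀ x : X, ∃ y ∈ F, x ∈ Metric.ball y ε := by
  refine Nat.sInf_mem (s := {k : ℕ | ∃ F : Finset X, F.card = k ∧
    ∀ x : X, ∃ y ∈ F, x ∈ Metric.ball y ε}) ?_
  obtain ⟨t, -, ht⟩ := isCompact_univ.elim_nhds_subcover (fun x : X => Metric.ball x ε)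
    fun x _ => Metric.ball_mem_nhds x hε
  exact ⟨_, t, rfl, fun x => by simpa using ht (Set.mem_univ x)⟩

/-! ### Comparison of the corruption with the embedded manifold. -/

section Corruption

variable {M : Type*} [TopologicalSpace M] [MeasurableSpace M] [BorelSpace M]
  (μ : Measure M) [IsProbabilityMeasure μ] {d : ℕ} {e : M → EuclideanSpace ℝ (Fin d)}
  (he : IsEmbedding e)

theorem measurePreserving_coe_image :
    MeasurePreserving (fun x : (image μ e he).carrier => (x : Set.range e).1)
      (image μ e he).measure (μ.map e) := by
  refine ⟨measurable_subtype_coe, ?_⟩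
  change Measure.map Subtype.val (Measure.map (Set.rangeFactorization e) μ) = _
  rw [Measure.map_map measurable_subtype_coe (measurable_rangeFactorization he.continuous)]
  rfl

variable [CompactSpace M]

/-- The image is compact in a Euclidean space, hence standard Borel. -/
theorem exists_isParametrization_image :
    ∃ φ : unitInterval → (image μ e he).carrier, (image μ e he).IsParametrization φ := by
  have : StandardBorelSpace (Set.range e) :=
    (isCompact_range he.continuous).measurableSet.standardBorel
  have : StandardBorelSpace (image μ e he).carrier := this
  exact exists_measurePreserving_unitInterval _

/-- The coupling: `[0,1]` is mapped onto the product of `[0,1]` with the noise space. The first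
coordinate preserves Lebesgue measure, so composing `ψ` and `χ` with it keeps their matching of
features while making room for the noise. -/
theorem exists_featuresMatch_corruption {X : MMSpace} {ψ : unitInterval → (image μ e he).carrier}
    {χ : unitInterval → X.carrier} (hψ : (image μ e he).IsParametrization ψ)
    (hχ : X.IsParametrization χ) {ε δ : ℝ} (hδ : 0 < δ) (σ : ℝ≥0)
    (h : FeaturesMatch (image μ e he) X ψ χ ε) (h1 : 2 * (σ : ℝ) ^ 2 / δ ^ 2 < δ)
    (h2 : (σ : ℝ) ^ 2 * coveringNumber (Set.range e) (δ / 2) / (δ / 2) ^ 2 < δ) :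
    ∃ (φ : unitInterval → (corruption μ e he σ).carrier) (χ' : unitInterval → X.carrier),
      (corruption μ e he σ).IsParametrization φ ∧ X.IsParametrization χ' ∧
        FeaturesMatch (corruption μ e he σ) X φ χ' (2 * δ + ε) := by
  let E := EuclideanSpace ℝ (Fin d)
  let s : unitInterval → Set.range e := ψ
  have hs : MeasurePreserving (fun t => (s t : E)) volume (μ.map e) :=
    (measurePreserving_coe_image μ he).comp hψ
  have : IsProbabilityMeasure (μ.map e) := 
    Measure.isProbabilityMeasure_map he.continuous.measurable.aemeasurable
  have : CompactSpace (Set.range e) := isCompact_iff_compactSpace.1 (isCompact_range he.continuous)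
  obtain ⟨p, hp⟩ := exists_measurePreserving_unitInterval
    ((volume : Measure unitInterval).prod (stdGaussian E))
  have hq : MeasurePreserving (Prod.fst ∘ p) := measurePreserving_fst.comp hp
  have hnoise : MeasurePreserving (fun y : E => (σ : ℝ) • y) (stdGaussian E)
      (gaussianNoise d σ) := ⟨by fun_prop, rfl⟩
  have hadd : MeasurePreserving (fun z : E × E => z.1 + z.2) ((μ.map e).prod (gaussianNoise d σ))
      ((μ.map e).conv (gaussianNoise d σ)) := ⟨by fun_prop, rfl⟩
  let φ : unitInterval → E := fun t => s (p t).1 + (σ : ℝ) • (p t).2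
  have hφ : MeasurePreserving φ volume ((μ.map e).conv (gaussianNoise d σ)) :=
    hadd.comp ((hs.prod hnoise).comp hp)
  have hclose : ∀ {f : E → ℝ} {g : Set.range e → ℝ}, LipschitzWith 1 f → LipschitzWith 1 g →
      (volume.prod (stdGaussian E)) {z | δ < |f (s z.1 + (σ : ℝ) • z.2) - g (s z.1)|} <
        ENNReal.ofReal δ → me1 (f ∘ φ) (g ∘ s ∘ Prod.fst ∘ p) < 2 * δ := by
    intro f g hf hg hfg
    refine me1_lt_iff.2 ⟨δ, hδ, by linarith, ?_⟩
    have hsm : Measurable s := hψ.measurable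
    have m1 : Measurable fun z : unitInterval × E => f (s z.1 + (σ : ℝ) • z.2) :=
      hf.continuous.measurable.comp (by fun_prop)
    have m2 : Measurable fun z : unitInterval × E => g (s z.1) :=
      hg.continuous.measurable.comp (by fun_prop)
    have hm : MeasurableSet {z : unitInterval × E | δ < |f (s z.1 + (σ : ℝ) • z.2) - g (s z.1)|} :=
      measurableSet_lt measurable_const (m1.sub m2).abs
    rwa [← hp.measure_preimage hm.nullMeasurableSet] at hfg
  have hpull : ∀ {g : Set.range e → ℝ} {k : X.carrier → ℝ}, LipschitzWith 1 g → LipschitzWith 1 k →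
      me1 (g ∘ s) (k ∘ χ) < ε → me1 (g ∘ s ∘ Prod.fst ∘ p) (k ∘ χ ∘ Prod.fst ∘ p) < ε :=
    fun hg hk h => me1_comp_le (hg.continuous.measurable.comp hψ.measurable)
      (hk.continuous.measurable.comp hχ.measurable) hq h
  refine ⟨φ, χ ∘ Prod.fst ∘ p, hφ, hχ.comp hq, fun f hf => ?_, fun k hk => ?_⟩
  -- The feature `f` is matched through its Gaussian average.
  · have hg := (lipschitzWith_integral_stdGaussian hf σ).comp (LipschitzWith.subtype_val (Set.range e))
    rw [one_mul] at hg
    obtain ⟨k, hk, hgk⟩ := h.1 _ hg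
    refine ⟨k, hk, me1_lt_add (hclose hf hg ?_) (hpull hg hk hgk)⟩
    exact (measure_lt_abs_sub_integral_le volume hs.measurable hf σ hδ).trans_lt
      ((ENNReal.ofReal_lt_ofReal_iff hδ).2 h1)
  -- The net has radius `δ / 2`, so that the error `2 * (δ / 2)` of the extension is `δ`.
  · obtain ⟨g, hg, hgk⟩ := h.2 k hk
    obtain ⟨F, hF, hcov⟩ := exists_finset_card_eq_coveringNumber (Set.range e) (half_pos hδ)
    obtain ⟨f, hf, hfg⟩ := exists_lipschitzWith_measure_lt_abs_sub_le
      (volume : Measure unitInterval) hg F (half_pos hδ) hcov σ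
    refine ⟨f, hf, me1_lt_add (hclose hf hg ?_) (hpull hg hk hgk)⟩
    have := hfg s
    rw [mul_div_cancel₀ δ two_ne_zero, hF] at this
    exact this.trans_lt ((ENNReal.ofReal_lt_ofReal_iff hδ).2 h2)

/-- Two embeddings inducing the same metric have isomorphic images. -/
theorem dconc_image_eq_zero {d' : ℕ} {e' : M → EuclideanSpace ℝ (Fin d')} (he' : IsEmbedding e')
    (h : ∀ x y, dist (e x) (e y) = dist (e' x) (e' y)) :
    dconc (image μ e he) (image μ e' he') = 0 := by
  let T : Set.range e ≃ₜ Set.range e' := he.toHomeomorph.symm.trans he'.toHomeomorph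
  have hT : ∀ x, T (Set.rangeFactorization e x) = Set.rangeFactorization e' x := fun x =>
    congrArg he'.toHomeomorph (he.toHomeomorph.symm_apply_apply x)
  have hiso : Isometry T := Isometry.of_dist_eq fun a b => by
    obtain ⟨x, rfl⟩ := Set.rangeFactorization_surjective a
    obtain ⟨y, rfl⟩ := Set.rangeFactorization_surjective b
    rw [hT, hT]
    exact (h x y).symm
  obtain ⟨φ, hφ⟩ := exists_isParametrization_image μ he
  refine dconc_eq_zero_of_isometryEquiv (X := image μ e he) (Y := image μ e' he')
    (⟨T.toEquiv, hiso⟩ : Set.range e ≃ᵢ Set.range e') ⟨hiso.continuous.measurable, ?_⟩ hφ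
  change Measure.map T (Measure.map (Set.rangeFactorization e) μ) =
    Measure.map (Set.rangeFactorization e') μ
  rw [Measure.map_map hiso.continuous.measurable (measurable_rangeFactorization he.continuous)]
  congr 1
  exact funext hT

end Corruption

theorem tendsto_dconc_corruption {M : Type*} [TopologicalSpace M] [CompactSpace M]
    [MeasurableSpace M] [BorelSpace M] (μ : Measure M) [IsProbabilityMeasure μ]
    (d : ℕ → ℕ) (hd : Tendsto d atTop atTop)
    (e : (n : ℕ) → M → EuclideanSpace ℝ (Fin (d n))) (he : ∀ n, IsEmbedding (e n))
    (hN : ∀ ε : ℝ, 0 < ε →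
      (fun n => (coveringNumber (Set.range (e n)) ε : ℝ)) =o[atTop] fun n => (d n : ℝ))
    (σ : ℕ → ℝ) (hσ_pos : ∀ n, 0 < σ n) (hσ : σ =O[atTop] fun n => 1 / √(d n : ℝ)) (X : MMSpace)
    (hX : Tendsto (fun n => dconc (image μ (e n) (he n)) X) atTop (𝓝 0)) :
    Tendsto (fun n => dconc (corruption μ (e n) (he n) (σ n)) X) atTop (𝓝 0) := by
  have hσ2 : (fun n => σ n ^ 2) =O[atTop] fun n => 1 / (d n : ℝ) := by
    simpa [div_pow] using hσ.pow 2
  have hσ0 : Tendsto (fun n => σ n ^ 2) atTop (𝓝 0) :=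
    hσ2.trans_tendsto (tendsto_const_nhds.div_atTop (tendsto_natCast_atTop_atTop.comp hd))
  have hσN : ∀ ε : ℝ, 0 < ε →
      Tendsto (fun n => σ n ^ 2 * coveringNumber (Set.range (e n)) ε) atTop (𝓝 0) := fun ε hε => by
    refine (isLittleO_one_iff ℝ).1 ((hσ2.mul_isLittleO (hN ε hε)).trans_isBigO ?_)
    refine IsBigO.of_bound 1 (Eventually.of_forall fun n => ?_)
    rw [one_div_mul_eq_div]
    -- When `d n = 0` the quotient is `0 / 0 = 0`, still at most `1`.
    by_cases h0 : (d n : ℝ) = 0 <;> simp [h0]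
  refine ENNReal.tendsto_nhds_zero.2 fun η hη => ?_
  obtain ⟨ε, hε0, hεη⟩ : ∃ ε : ℝ, 0 < ε ∧ ENNReal.ofReal ε ≤ η := by
    obtain ⟨r, hr0, hr⟩ := ENNReal.lt_iff_exists_nnreal_btwn.1 hη
    exact ⟨r, by exact_mod_cast hr0, by rw [ENNReal.ofReal_coe_nnreal]; exact hr.le⟩
  -- The noise costs `2 * (ε / 4)` and the distance from the image to `X` less than `ε / 2`, in
  -- total less than `ε`.
  have hδ : 0 < ε / 4 := by positivity
  have e1 : ∀ᶠ n in atTop, 2 * σ n ^ 2 / (ε / 4) ^ 2 < ε / 4 :=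
    ((hσ0.const_mul 2).div_const _).eventually_lt_const (by simpa using hε0)
  have e2 : ∀ᶠ n in atTop, σ n ^ 2 * coveringNumber (Set.range (e n)) (ε / 4 / 2) /
      (ε / 4 / 2) ^ 2 < ε / 4 :=
    ((hσN _ (half_pos hδ)).div_const _).eventually_lt_const (by simpa using hε0)
  have e3 : ∀ᶠ n in atTop, dconc (image μ (e n) (he n)) X < ENNReal.ofReal (ε / 2) :=
    hX.eventually_lt_const (ENNReal.ofReal_pos.2 (by positivity))
  filter_upwards [e1, e2, e3] with n h1 h2 h3
  obtain ⟨ε', h0, hlt, ψ, χ, hψ, hχ, hm⟩ := exists_featuresMatch_of_dconc_lt h3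
  obtain ⟨φ, χ', hφ, hχ', hm'⟩ := exists_featuresMatch_corruption μ (he n) hψ hχ hδ
    ⟨σ n, (hσ_pos n).le⟩ hm h1 h2
  refine (dconc_le hφ hχ' (by positivity) hm').trans ((ENNReal.ofReal_le_ofReal ?_).trans hεη)
  linarith

end MMSpace

theorem mainTheorem11
    (𝓜 : Set MMSpace) (dim : 𝓜 → ℝ≥0∞) (hdim : MMSpace.IsDimensionFunction 𝓜 dim)
    {m : ℕ} {M : Type*} [TopologicalSpace M] [T2Space M] [SecondCountableTopology M]
    [CompactSpace M] [ChartedSpace (EuclideanSpace ℝ (Fin m)) M]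
    [MeasurableSpace M] [BorelSpace M] (μ : Measure M) [IsProbabilityMeasure μ]
    (d : ℕ → ℕ) (hd : Tendsto d atTop atTop)
    (e : (n : ℕ) → M → EuclideanSpace ℝ (Fin (d n))) (he : ∀ n, IsEmbedding (e n))
    (hN : ∀ ε : ℝ, 0 < ε →
      (fun n => (MMSpace.coveringNumber (Set.range (e n)) ε : ℝ)) =o[atTop] fun n => (d n : ℝ))
    (σ : ℕ → ℝ) (hσ_pos : ∀ n, 0 < σ n)
    (hσ : σ =O[atTop] fun n => 1 / √(d n : ℝ))
    (hC : ∀ n, MMSpace.corruption μ (e n) (he n) (σ n) ∈ 𝓜) :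
    -- the embeddings induce one and the same metric on `M`, so that `M` is a single mm-space
    ((∀ n x y, dist (e n x) (e n y) = dist (e 0 x) (e 0 y)) →
      ∀ hM : MMSpace.image μ (e 0) (he 0) ∈ 𝓜,
        Tendsto (fun n => dim ⟨MMSpace.corruption μ (e n) (he n) (σ n), hC n⟩) atTop
          (𝓝 (dim ⟨MMSpace.image μ (e 0) (he 0), hM⟩))) ∧
    -- more generally, the metrics may vary with `n`, the images tending to an mm-space `X`
    (∀ X : 𝓜,
      Tendsto (fun n => MMSpace.dconc (MMSpace.image μ (e n) (he n)) X) atTop (𝓝 0) →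
      Tendsto (fun n => dim ⟨MMSpace.corruption μ (e n) (he n) (σ n), hC n⟩) atTop
        (𝓝 (dim X))) := by
  have main : ∀ X : 𝓜,
      Tendsto (fun n => MMSpace.dconc (MMSpace.image μ (e n) (he n)) X) atTop (𝓝 0) →
      Tendsto (fun n => dim ⟨MMSpace.corruption μ (e n) (he n) (σ n), hC n⟩) atTop
        (𝓝 (dim X)) := fun X hX =>
    hdim.smooth_dependence _ X
      (MMSpace.tendsto_dconc_corruption μ d hd e he hN σ hσ_pos hσ X hX)
  -- For a common metric all images are isomorphic to the first, so the general case applies with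
  -- constant distance zero.
  refine ⟨fun hiso hM => main ⟨_, hM⟩ ?_, main⟩
  simp only [MMSpace.dconc_image_eq_zero μ (he _) (he 0) (hiso _)]
  exact tendsto_const_nhds
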